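/- **Proposition (Universal approximation).** Let $K\subseteq\mathbb R^d$ be compact with positive Lebesgue measure, let $P$ be the uniform distribution (normalized Lebesgue measure) on $K$, and let $\mathcal V\subseteq C(K)$ be dense in the supremum norm. For $V\in\mathcal V$ let $$Q_V=\frac1Z e^{-V}P,\qquad Z=\mathbb E_P[e^{-V}].$$ Then every $Q_V$ is a probability measure on $K$ with a continuous density with respect to Lebesgue measure, and the class $\{Q_V : V\in\mathcal V\}$ is * dense in $\mathcal P(\operatorname{supp}P)$ under the Wasserstein metric $W_p$, for every $1\le p<\infty$: for every probability measure $Q$ on $K$ with $\operatorname{supp}Q\subseteq\operatorname{supp}P$ and every $\varepsilon>0$ there is $V\in\mathcal V$ with $W_p(Q,Q_V)<\varepsilon$. In particular it is dense in the set $\mathcal P(K)$ of all probability measures on $K$ whenever every nonempty relatively open subset of $K$ has positive Lebesgue measure (i.e. $\operatorname{supp}P=K$); * dense in the set $\mathcal P_{ac}(K)$ of absolutely continuous probability measures on $K$ under the total variation norm $\|\cdot\|_{TV}$; * dense, under KL divergence, in the set of probability measures $Q$ on $K$ whose density is a continuous function on $K$: for every such $Q$ and every $\varepsilon>0$ there is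 $V\in\mathcal V$ with $\mathrm{KL}(Q\,\|\,Q_V)<\varepsilon$. Moreover, the following two classes are dense in $C(K)$, so that the above holds for them: 1. *Barron space.* Let $\sigma:\mathbb R\to\mathbb R$ be continuous and not a polynomial. For $U:\mathbb R^d\to\mathbb R$ let $$\|U\|_{\mathcal B}=\inf_\rho\Big(\mathbb E_{\rho(a,w,b)}\big[a^2(\|w\|^2+b^2)\big]\Big)^{1/2},$$ the infimum over all probability measures $\rho$ on $\mathbb R\times\mathbb R^d\times\mathbb R$ with $U(x)=\mathbb E_{\rho}[a\,\sigma(w\cdot x+b)]$ (an absolutely convergent expectation) for all $x\in\mathbb R^d$, and $\|U\|_{\mathcal B}=\infty$ if there is none. The class $\mathcal V$ consists of the continuous functions on $K$ that are restrictions of functions $U$ with $\|U\|_{\mathcal B}<\infty$. 2. *RKHS.* Let $\rho_0$ be a probability measure on $\mathbb R^d\times\mathbb R$, and assume that either $\sigma$ is continuous, not a polynomial, satisfies $\sigma(t)=O(|t|)$ as $|t|\to\infty$, and $\rho_0$ has full support; or $\sigma(t)=\max(t,0)$ and for every $(w,b)\ne 0$ there is $\lambda>0$ with $\lambda(w,b)\in\operatorname{supp}\rho_0$.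 For $U:\mathbb R^d\to\mathbb R$ let $\|U\|_{\mathcal H}=\inf_a\|a\|_{L^2(\rho_0)}$, the infimum over all measurable $a:\mathbb R^d\times\mathbb R\to\mathbb R$ with $U(x)=\mathbb E_{\rho_0(w,b)}[a(w,b)\,\sigma(w\cdot x+b)]$ (an absolutely convergent expectation) for all $x\in\mathbb R^d$, and $\|U\|_{\mathcal H}=\infty$ if there is none. The class $\mathcal V$ consists of the continuous functions on $K$ that are restrictions of functions $U$ with $\|U\|_{\mathcal H}<\infty$. -/

import Mathlib

open MeasureTheory Filter Topology
open scoped ENNReal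

noncomputable section

namespace BiasPotential

/-- The space `ℝ^d` with its Euclidean norm. -/
abbrev Space (d : ℕ) : Type := EuclideanSpace ℝ (Fin d)

/-! ### Distances between probability measures -/

/-- `π` is a coupling of `μ` and `ν`: its two marginals are `μ` and `ν`. -/
def IsCoupling {X : Type*} [MeasurableSpace X] (π : Measure (X × X)) (μ ν : Measure X) : Prop :=
  π.map Prod.fst = μ ∧ π.map Prod.snd = ν

/-- The Wasserstein distance
`W_p(μ, ν) = (inf over couplings π of ∫ dist(x, y)^p dπ(x, y))^(1/p)`. -/
def wasserstein {X : Type*} [MeasurableSpace X] [PseudoEMetricSpace X] (p : ℝ)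
    (μ ν : Measure X) : ℝ≥0∞ :=
  (⨅ (π : Measure (X × X)) (_ : IsCoupling π μ ν), ∫⁻ z, edist z.1 z.2 ^ p ∂π) ^ (1 / p)

/-- The total variation norm `‖μ - ν‖_TV`: the total mass of the variation of the signed measure
`μ - ν`. -/
def tvDist {X : Type*} [MeasurableSpace X] (μ ν : Measure X)
    [IsFiniteMeasure μ] [IsFiniteMeasure ν] : ℝ≥0∞ :=
  (μ.toSignedMeasure - ν.toSignedMeasure).totalVariation Set.univ

/-! ### Distributions over `K`

Measures over `K` are measures on the subtype `K`. -/

/-- The Lebesgue measure on `K`. -/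
def lebesgue {d : ℕ} (K : Set (Space d)) : Measure K :=
  (volume : Measure (Space d)).comap Subtype.val

/-- The uniform distribution over `K`: normalized Lebesgue measure. -/
def uniform {d : ℕ} (K : Set (Space d)) : Measure K :=
  (lebesgue K Set.univ)⁻¹ • lebesgue K

/-- The Boltzmann distribution `Z⁻¹ e^{-V} P`, `Z = E_P[e^{-V}]`, with `P` uniform over `K`. -/
def boltzmann {d : ℕ} (K : Set (Space d)) (V : C(K, ℝ)) : Measure K :=
  (uniform K).withDensity
    fun x => ENNReal.ofReal ((∫ y, Real.exp (-V y) ∂(uniform K))⁻¹ * Real.exp (-V x))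

instance {d : ℕ} (K : Set (Space d)) (V : C(K, ℝ)) : IsFiniteMeasure (boltzmann K V) := by
  have h : boltzmann K V = (uniform K).tilted fun x => -V x := by
    unfold boltzmann Measure.tilted
    simp only [div_eq_inv_mul]
  rw [h]
  infer_instance

/-- `Q` has a continuous density on `K` with respect to Lebesgue measure. -/
def HasContinuousDensity {d : ℕ} {K : Set (Space d)} (Q : Measure K) : Prop :=
  ∃ f : C(K, ℝ), (∀ x, 0 ≤ f x) ∧ Q = (lebesgue K).withDensity fun x => ENNReal.ofReal (f x)

/-- The Boltzmann distributions with potentials in `𝒱` are probability measures with continuous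
densities, and they are dense
* under `W_p`, `1 ≤ p < ∞`, in the probability measures over `K` whose support lies in the
  support of the uniform distribution `P` (that is all probability measures over `K` when `P` has
  full support);
* under total variation in the absolutely continuous probability measures over `K`;
* under the Kullback-Leibler divergence `KL(Q ‖ ·)` in the probability measures `Q` over `K` with
  continuous density. -/
def UniversalApproximation {d : ℕ} (K : Set (Space d)) (𝒱 : Set C(K, ℝ)) : Prop :=
  (∀ V ∈ 𝒱, IsProbabilityMeasure (boltzmann K V) ∧ HasContinuousDensity (boltzmann K V)) ∧
  (∀ p : ℝ, 1 ≤ p → ∀ Q : Measure K, IsProbabilityMeasure Q →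
    Q.support ⊆ (uniform K).support →
    ∀ ε : ℝ≥0∞, 0 < ε → ∃ V ∈ 𝒱, wasserstein p Q (boltzmann K V) < ε) ∧
  (∀ Q : Measure K, ∀ _ : IsProbabilityMeasure Q, Q ≪ lebesgue K →
    ∀ ε : ℝ≥0∞, 0 < ε → ∃ V ∈ 𝒱, tvDist Q (boltzmann K V) < ε) ∧
  (∀ Q : Measure K, IsProbabilityMeasure Q → HasContinuousDensity Q →
    ∀ ε : ℝ≥0∞, 0 < ε → ∃ V ∈ 𝒱, InformationTheory.klDiv Q (boltzmann K V) < ε)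

/-! ### Function representations -/

/-- `V(x) = E_{ρ(a,w,b)}[a σ(w·x + b)]` for all `x ∈ ℝ^d` (the expectation being well defined). -/
def RepresentsNetwork {d : ℕ} (σ : ℝ → ℝ) (ρ : Measure (ℝ × Space d × ℝ)) (V : Space d → ℝ) :
    Prop :=
  ∀ x : Space d,
    Integrable (fun θ : ℝ × Space d × ℝ => θ.1 * σ (inner ℝ θ.2.1 x + θ.2.2)) ρ ∧
    V x = ∫ θ, θ.1 * σ (inner ℝ θ.2.1 x + θ.2.2) ∂ρ

/-- The path norm `‖ρ‖_P = (E_ρ[a² (‖w‖² + b²)])^(1/2)`. -/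
def pathNorm {d : ℕ} (ρ : Measure (ℝ × Space d × ℝ)) : ℝ≥0∞ :=
  (∫⁻ θ, ENNReal.ofReal (θ.1 ^ 2 * (‖θ.2.1‖ ^ 2 + θ.2.2 ^ 2)) ∂ρ) ^ (1 / 2 : ℝ)

/-- The Barron norm: the infimum of the path norms of the parameter distributions representing
`V` (it is `∞` when there is none). -/
def barronNorm {d : ℕ} (σ : ℝ → ℝ) (V : Space d → ℝ) : ℝ≥0∞ :=
  ⨅ (ρ : Measure (ℝ × Space d × ℝ)) (_ : IsProbabilityMeasure ρ) (_ : RepresentsNetwork σ ρ V),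
    pathNorm ρ

/-- `V(x) = E_{ρ₀(w,b)}[a(w,b) σ(w·x + b)]` for all `x ∈ ℝ^d` (the expectation being well
defined). -/
def RepresentsRandomFeature {d : ℕ} (σ : ℝ → ℝ) (ρ₀ : Measure (Space d × ℝ))
    (a : Space d × ℝ → ℝ) (V : Space d → ℝ) : Prop :=
  ∀ x : Space d,
    Integrable (fun θ : Space d × ℝ => a θ * σ (inner ℝ θ.1 x + θ.2)) ρ₀ ∧
    V x = ∫ θ, a θ * σ (inner ℝ θ.1 x + θ.2) ∂ρ₀

/-- The RKHS norm: the infimum of `‖a‖_{L²(ρ₀)}` over the coefficient functions `a` representing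
`V` (it is `∞` when there is none). -/
def rkhsNorm {d : ℕ} (σ : ℝ → ℝ) (ρ₀ : Measure (Space d × ℝ)) (V : Space d → ℝ) : ℝ≥0∞ :=
  ⨅ (a : Space d × ℝ → ℝ) (_ : AEStronglyMeasurable a ρ₀)
    (_ : RepresentsRandomFeature σ ρ₀ a V), eLpNorm a 2 ρ₀

/-- The continuous functions on `K` that are restrictions of functions of finite Barron norm. -/
def barronSpace {d : ℕ} (σ : ℝ → ℝ) (K : Set (Space d)) : Set C(K, ℝ) :=
  {V | ∃ U : Space d → ℝ, barronNorm σ U < ∞ ∧ ∀ x : K, V x = U x}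

/-- The continuous functions on `K` that are restrictions of functions of finite RKHS norm. -/
def rkhsSpace {d : ℕ} (σ : ℝ → ℝ) (ρ₀ : Measure (Space d × ℝ)) (K : Set (Space d)) :
    Set C(K, ℝ) :=
  {V | ∃ U : Space d → ℝ, rkhsNorm σ ρ₀ U < ∞ ∧ ∀ x : K, V x = U x}

/-! ### Assumptions on the activation function and the parameter distribution -/

/-- `σ` is not a polynomial function. -/
def NonPolynomial (σ : ℝ → ℝ) : Prop :=
  ¬ ∃ q : Polynomial ℝ, ∀ t, σ t = q.eval t

/-- The ReLU activation. -/
def relu (t : ℝ) : ℝ := max t 0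

/-- Up to positive scaling, the support of `ρ₀` contains every nonzero parameter `(w, b)`. -/
def CoversAllDirections {d : ℕ} (ρ₀ : Measure (Space d × ℝ)) : Prop :=
  ∀ θ : Space d × ℝ, θ ≠ 0 → ∃ c : ℝ, 0 < c ∧ c • θ ∈ ρ₀.support

/-- The assumption on the random feature model: either `σ` is continuous, non-polynomial and of at
most linear growth and `ρ₀` has full support, or `σ` is ReLU and `ρ₀` covers all directions. -/
def RandomFeatureAssumption {d : ℕ} (σ : ℝ → ℝ) (ρ₀ : Measure (Space d × ℝ)) : Prop :=
  (Continuous σ ∧ NonPolynomial σ ∧ (σ =O[cocompact ℝ] fun t => |t|) ∧ ρ₀.support = Set.univ) ∨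
  (σ = relu ∧ CoversAllDirections ρ₀)

end BiasPotential

end

noncomputable section

namespace BiasPotential

/-! ### Moving averages -/

/-! The argument has two independent halves.

Approximation of measures. Let `Q = f P` have a continuous density. Mixing `f` with a little of the
constant `1` makes it positive, so its negative logarithm is a continuous potential, and a nearby
`V` in the dense class satisfies `c Q ≤ Q_V` with `c < 1` as close to `1` as desired
(`exists_smul_le_boltzmann`). This one-sided bound controls every distance: KL is at most `log (1 /
c)`, the measures differ by at most `1 - c` on each set, and a coupling with `Q` extends to one with
`Q_V` by moving only mass `1 - c` arbitrarily. A general `Q` is first replaced by one with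
continuous density: by `L¹` approximation of its density for total variation, by smoothing with a
bump kernel normalized with respect to `P` for `W_p`.

Density of the function classes. Let `S` be the closed span of the neurons, and `u(x) = ⟨w, x⟩`.
Averaging in the bias replaces `σ` by a smoother function without leaving `S`; differentiating `n`
times in the scale `l` at `l = 0` then gives a constant multiple of `u ^ n`. The constant can be
chosen nonzero, as otherwise `σ` would be a limit of polynomials of bounded degree. So `S` contains
`exp u`, and Stone-Weierstrass applies to the algebra of exponentials. Finite sums of neurons are
Barron functions; RKHS functions approximate a neuron by averaging over a small ball of parameters.
-/

/-- The average of `f` over the segment from `t` to `t + h`. -/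
def movingAverage (h : ℝ) (f : ℝ → ℝ) (t : ℝ) : ℝ := ∫ s in (0 : ℝ)..1, f (t + h * s)

theorem movingAverage_eq {h : ℝ} (hh : h ≠ 0) (f : ℝ → ℝ) (t : ℝ) :
    movingAverage h f t = h⁻¹ * ∫ s in t..t + h, f s := by
  simp [movingAverage, intervalIntegral.integral_comp_add_mul f hh]

theorem hasDerivAt_movingAverage {h : ℝ} (hh : h ≠ 0) {f : ℝ → ℝ} (hf : Continuous f) (t : ℝ) :
    HasDerivAt (movingAverage h f) (h⁻¹ * (f (t + h) - f t)) t := by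
  have key : movingAverage h f =
      fun t => h⁻¹ * ((∫ s in (0 : ℝ)..t + h, f s) - ∫ s in (0 : ℝ)..t, f s) := by
    funext t
    rw [movingAverage_eq hh, intervalIntegral.integral_interval_sub_left
      (hf.intervalIntegrable _ _) (hf.intervalIntegrable _ _)]
  have h1 (u : ℝ) : HasDerivAt (fun u => ∫ s in (0 : ℝ)..u, f s) (f u) u :=
    intervalIntegral.integral_hasDerivAt_right (hf.intervalIntegrable _ _)
      hf.aestronglyMeasurable.stronglyMeasurableAtFilter hf.continuousAt
  rw [key]
  exact (((h1 (t + h)).comp_add_const t h).sub (h1 t)).const_mul _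

/-- The derivative of the average is a difference quotient of `f`, hence as smooth as `f`: one order
of smoothness is gained. -/
theorem contDiff_movingAverage {h : ℝ} (hh : h ≠ 0) {f : ℝ → ℝ} {n : ℕ} (hf : ContDiff ℝ n f) :
    ContDiff ℝ (n + 1 : ℕ) (movingAverage h f) := by
  have hd := hasDerivAt_movingAverage hh hf.continuous
  rw [Nat.cast_add, Nat.cast_one, contDiff_succ_iff_deriv]
  refine ⟨fun t => (hd t).differentiableAt, by simp, ?_⟩
  rw [show deriv (movingAverage h f) = fun t => h⁻¹ * (f (t + h) - f t) from
    funext fun t => (hd t).deriv]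
  fun_prop

theorem contDiff_iterate_movingAverage {h : ℝ} (hh : h ≠ 0) {f : ℝ → ℝ} (hf : Continuous f)
    (n : ℕ) : ContDiff ℝ n ((movingAverage h)^[n] f) := by
  induction n with
  | zero => simpa using hf
  | succ n ih =>
    rw [Function.iterate_succ_apply']
    exact contDiff_movingAverage hh ih

/-- The `n`-fold average at `t` only sees `f` on `[t, t + n h]`; each averaging step consumes one
length `h`. -/
theorem abs_iterate_movingAverage_sub_le {h : ℝ} (hh : 0 < h) {f : ℝ → ℝ} (hf : Continuous f)
    {c ε : ℝ} (n : ℕ) {t : ℝ} (hft : ∀ s ∈ Set.Icc t (t + n * h), |f s - c| ≤ ε) :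
    |(movingAverage h)^[n] f t - c| ≤ ε := by
  induction n generalizing t with
  | zero => simpa using hft t (by simp)
  | succ n ih =>
    rw [Function.iterate_succ_apply']
    have hc : Continuous ((movingAverage h)^[n] f) :=
      (contDiff_iterate_movingAverage hh.ne' hf n).continuous
    have e : movingAverage h ((movingAverage h)^[n] f) t - c =
        ∫ s in (0 : ℝ)..1, ((movingAverage h)^[n] f (t + h * s) - c) := by
      rw [intervalIntegral.integral_sub
        (Continuous.intervalIntegrable (by fun_prop) _ _) (by simp)]
      simp [movingAverage]
    rw [e, ← Real.norm_eq_abs]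
    refine (intervalIntegral.norm_integral_le_of_norm_le_const (C := ε) fun s hs => ?_).trans_eq
      (by simp)
    rw [Set.uIoc_of_le zero_le_one] at hs
    refine ih fun r hr => hft r ⟨?_, ?_⟩
    · nlinarith [hr.1, hs.1]
    · push_cast
      nlinarith [hr.2, hs.2]

theorem tendsto_iterate_movingAverage {f : ℝ → ℝ} (hf : Continuous f) (n : ℕ) (t : ℝ) :
    Tendsto (fun h => (movingAverage h)^[n] f t) (𝓝[>] 0) (𝓝 (f t)) := by
  refine Metric.tendsto_nhds.2 fun ε hε => ?_
  obtain ⟨δ, hδ, hfδ⟩ := Metric.continuous_iff.1 hf t (ε / 2) (half_pos hε)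
  have hsmall : Tendsto (fun h : ℝ => (n : ℝ) * h) (𝓝[>] 0) (𝓝 0) := by
    have : Tendsto (fun h : ℝ => (n : ℝ) * h) (𝓝 0) (𝓝 (n * 0)) := by
      exact (continuous_const.mul continuous_id).tendsto 0
    rw [mul_zero] at this
    exact this.mono_left nhdsWithin_le_nhds
  filter_upwards [hsmall.eventually_lt_const hδ, self_mem_nhdsWithin] with h h1 h2
  refine lt_of_le_of_lt ?_ (half_lt_self hε)
  rw [Real.dist_eq]
  refine abs_iterate_movingAverage_sub_le h2 hf n fun s hs => ?_
  rw [← Real.dist_eq]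
  refine (hfδ s ?_).le
  rw [Real.dist_eq, abs_of_nonneg (by linarith [hs.1])]
  linarith [hs.2]

/-! ### Polynomials -/

theorem exists_polynomial_derivative_eq (q : Polynomial ℝ) {n : ℕ} (hq : q.degree < n) :
    ∃ p : Polynomial ℝ, p.degree < (n + 1 : ℕ) ∧ p.derivative = q := by
  refine ⟨∑ i ∈ Finset.range n, Polynomial.monomial (i + 1) (q.coeff i / (i + 1)), ?_, ?_⟩
  · refine (Polynomial.degree_sum_le _ _).trans_lt ((Finset.sup_lt_iff (by simp)).2 fun i hi => ?_)
    refine (Polynomial.degree_monomial_le _ _).trans_lt ?_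
    have := Finset.mem_range.1 hi
    exact_mod_cast (by omega : i + 1 < n + 1)
  · ext k
    have hk : (k : ℝ) + 1 ≠ 0 := by positivity
    simp only [Polynomial.coeff_derivative, Polynomial.finsetSum_coeff, Polynomial.coeff_monomial,
      add_left_inj, Finset.sum_ite_eq', Finset.mem_range]
    split_ifs with h
    · field_simp
    · rw [zero_mul, Polynomial.coeff_eq_zero_of_degree_lt]
      exact hq.trans_le (by exact_mod_cast not_lt.1 h)

theorem exists_polynomial_of_iteratedDeriv_eq_zero {n : ℕ} {f : ℝ → ℝ} (hf : ContDiff ℝ n f)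
    (h0 : ∀ t, iteratedDeriv n f t = 0) :
    ∃ p : Polynomial ℝ, p.degree < n ∧ ∀ t, f t = p.eval t := by
  induction n generalizing f with
  | zero => exact ⟨0, by simp, by simpa using h0⟩
  | succ n ih =>
    rw [Nat.cast_add, Nat.cast_one, contDiff_succ_iff_deriv] at hf
    obtain ⟨q, hq, hfq⟩ := ih hf.2.2 fun t => by rw [← iteratedDeriv_succ']; exact h0 t
    obtain ⟨p, hp, rfl⟩ := exists_polynomial_derivative_eq q hq
    have hconst := is_const_of_deriv_eq_zero (f := fun t => f t - p.eval t)
      (hf.1.sub p.differentiable) fun t => by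
        rw [deriv_fun_sub (hf.1 t) p.differentiable.differentiableAt, hfq, Polynomial.deriv,
          sub_self]
    refine ⟨p + Polynomial.C (f 0 - p.eval 0), ?_, fun t => ?_⟩
    · refine (Polynomial.degree_add_le _ _).trans_lt (max_lt hp ?_)
      refine Polynomial.degree_C_le.trans_lt ?_
      exact_mod_cast Nat.succ_pos n
    · have := hconst t 0
      simp only [Polynomial.eval_add, Polynomial.eval_C]
      linarith

/-- A polynomial of degree below `n` is the Lagrange interpolant of its values at `0, ..., n - 1`,
and the interpolant depends continuously on these values. The uniform degree bound is essential. -/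
theorem exists_polynomial_of_tendsto {ι : Type*} {l : Filter ι} [l.NeBot] {n : ℕ}
    {p : ι → Polynomial ℝ} {f : ℝ → ℝ} (hp : ∀ᶠ i in l, (p i).degree < n)
    (hf : ∀ t, Tendsto (fun i => (p i).eval t) l (𝓝 (f t))) :
    ∃ q : Polynomial ℝ, ∀ t, f t = q.eval t := by
  have hinj : Set.InjOn (fun k : ℕ => (k : ℝ)) (Finset.range n) := Nat.cast_injective.injOn
  refine ⟨Lagrange.interpolate (Finset.range n) (fun k : ℕ => (k : ℝ)) fun k => f k, fun t => ?_⟩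
  refine tendsto_nhds_unique (hf t) ?_
  have h : Tendsto (fun i => (Lagrange.interpolate (Finset.range n) (fun k : ℕ => (k : ℝ))
      fun k => (p i).eval (k : ℝ)).eval t) l (𝓝 ((Lagrange.interpolate (Finset.range n)
      (fun k : ℕ => (k : ℝ)) fun k => f k).eval t)) := by
    simp only [Lagrange.interpolate_apply, Polynomial.eval_finsetSum, Polynomial.eval_mul,
      Polynomial.eval_C]
    exact tendsto_finsetSum _ fun k _ => (hf k).mul_const _
  refine h.congr' ?_
  filter_upwards [hp] with i hi
  rw [← Lagrange.eq_interpolate hinj (by simpa using hi)]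

/-- For a continuous non-polynomial `f` and any `n`, some `n`-fold moving average of `f` has
a nonvanishing `n`-th derivative. -/
theorem NonPolynomial.exists_iteratedDeriv_ne_zero {f : ℝ → ℝ} (hf : Continuous f)
    (hp : NonPolynomial f) (n : ℕ) :
    ∃ h t : ℝ, h ≠ 0 ∧ iteratedDeriv n ((movingAverage h)^[n] f) t ≠ 0 := by
  -- Otherwise every `n`-fold average is a polynomial of degree below `n`, and so is recovered `f`
  -- itself as a polynomial when `h → 0+`.
  by_contra! hcon
  have hpoly (h : ℝ) : ∃ p : Polynomial ℝ, h ≠ 0 →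
      p.degree < n ∧ ∀ t, (movingAverage h)^[n] f t = p.eval t := by
    by_cases hh : h = 0
    · exact ⟨0, fun h' => absurd hh h'⟩
    · obtain ⟨p, hp⟩ := exists_polynomial_of_iteratedDeriv_eq_zero
        (contDiff_iterate_movingAverage hh hf n) (hcon h · hh)
      exact ⟨p, fun _ => hp⟩
  choose p hp' using hpoly
  refine hp (exists_polynomial_of_tendsto (l := 𝓝[>] 0) (p := p) (n := n) ?_ fun t => ?_)
  · filter_upwards [self_mem_nhdsWithin] with h hh using (hp' h (ne_of_gt hh)).1
  · refine (tendsto_iterate_movingAverage hf n t).congr' ?_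
    filter_upwards [self_mem_nhdsWithin] with h hh using (hp' h (ne_of_gt hh)).2 t

/-! ### Closed subspaces of `C(X, ℝ)` containing a ridge family -/

section Ridge

variable {X : Type*} [TopologicalSpace X]

/-- The function `x ↦ g (l u(x) + b)`. -/
def ridge (g : C(ℝ, ℝ)) (u : C(X, ℝ)) (l b : ℝ) : C(X, ℝ) :=
  ⟨fun x => g (l * u x + b), by fun_prop⟩

@[simp]
theorem ridge_apply (g : C(ℝ, ℝ)) (u : C(X, ℝ)) (l b : ℝ) (x : X) :
    ridge g u l b x = g (l * u x + b) := rfl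

theorem continuous_ridge (g : C(ℝ, ℝ)) (u : C(X, ℝ)) :
    Continuous fun p : ℝ × ℝ => ridge g u p.1 p.2 := by
  refine ContinuousMap.continuous_of_continuous_uncurry _ ?_
  simp only [Function.uncurry_def, ridge_apply]
  fun_prop

variable [CompactSpace X]

/-- Pointwise derivatives upgrade to a derivative in sup norm: since `G` is norm continuous, `F` is
a constant plus the Bochner integral of `G`, as evaluation at each point shows. -/
theorem hasDerivAt_of_hasDerivAt_apply {F G : ℝ → C(X, ℝ)} (hG : Continuous G)
    (hFG : ∀ x l, HasDerivAt (fun l => F l x) (G l x) l) (l : ℝ) : HasDerivAt F (G l) l := by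
  have key : F = fun l => F 0 + ∫ s in (0 : ℝ)..l, G s := by
    funext l
    ext x
    have h1 : (∫ s in (0 : ℝ)..l, G s) x = ∫ s in (0 : ℝ)..l, G s x :=
      ((ContinuousMap.evalCLM ℝ x).intervalIntegral_comp_comm
        (hG.intervalIntegrable 0 l)).symm
    have h2 : Continuous fun s => G s x := (continuous_eval_const x).comp hG
    rw [ContinuousMap.add_apply, h1, intervalIntegral.integral_eq_sub_of_hasDerivAt
      (fun s _ => hFG x s) (h2.intervalIntegrable 0 l)]
    ring
  rw [key]
  exact (intervalIntegral.integral_hasDerivAt_right (hG.intervalIntegrable _ _)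
    hG.aestronglyMeasurable.stronglyMeasurableAtFilter hG.continuousAt).const_add _

theorem mem_of_hasDerivAt {E : Type*} [NormedAddCommGroup E] [NormedSpace ℝ E]
    {S : Submodule ℝ E} (hS : IsClosed (S : Set E)) {F : ℝ → E} {F' : E} {l : ℝ}
    (h : HasDerivAt F F' l) (hF : ∀ l, F l ∈ S) : F' ∈ S := by
  refine hS.mem_of_tendsto (hasDerivAt_iff_tendsto_slope.1 h) (Eventually.of_forall fun m => ?_)
  exact S.smul_mem _ (S.sub_mem (hF m) (hF l))

variable {S : Submodule ℝ C(X, ℝ)} {u : C(X, ℝ)}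

/-- Averaging `g` amounts to averaging ridge functions over the bias `b`, and a closed convex set
contains the barycentres of probability measures on it. -/
theorem ridge_movingAverage_mem (hS : IsClosed (S : Set C(X, ℝ))) {g g' : C(ℝ, ℝ)} {h : ℝ}
    (hg : ∀ l b, ridge g u l b ∈ S) (hg' : ∀ t, g' t = movingAverage h g t) (l b : ℝ) :
    ridge g' u l b ∈ S := by
  have hc : Continuous fun s : ℝ => ridge g u l (b + h * s) :=
    (continuous_ridge g u).comp (by fun_prop : Continuous fun s : ℝ => (l, b + h * s))
  have e : ridge g' u l b = ∫ s in Set.Ioc (0 : ℝ) 1, ridge g u l (b + h * s) := by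
    ext x
    rw [← intervalIntegral.integral_of_le zero_le_one]
    have h1 : (∫ s in (0 : ℝ)..1, ridge g u l (b + h * s)) x =
        ∫ s in (0 : ℝ)..1, ridge g u l (b + h * s) x :=
      ((ContinuousMap.evalCLM ℝ x).intervalIntegral_comp_comm
        (hc.intervalIntegrable 0 1)).symm
    rw [h1, ridge_apply, hg', movingAverage]
    simp only [ridge_apply, add_assoc]
  have : IsProbabilityMeasure (volume.restrict (Set.Ioc (0 : ℝ) 1)) := ⟨by simp⟩
  rw [e]
  refine S.convex.integral_mem hS (Eventually.of_forall fun s => hg _ _) ?_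
  have := hc.intervalIntegrable (μ := volume) 0 1
  rwa [intervalIntegrable_iff_integrableOn_Ioc_of_le zero_le_one] at this

theorem ridge_iterate_movingAverage_mem (hS : IsClosed (S : Set C(X, ℝ))) {σ : ℝ → ℝ}
    (hσ : Continuous σ) (hmem : ∀ l b, ridge ⟨σ, hσ⟩ u l b ∈ S) {h : ℝ} (hh : h ≠ 0) (n : ℕ)
    (l b : ℝ) : ridge ⟨_, (contDiff_iterate_movingAverage hh hσ n).continuous⟩ u l b ∈ S := by
  induction n generalizing l b with
  | zero => exact hmem l b
  | succ n ih =>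
    refine ridge_movingAverage_mem hS (h := h) ih (fun t => ?_) l b
    simp [Function.iterate_succ_apply']

/-- Each derivative in `l` brings down one factor `u`, and stays in `S` as a limit of difference
quotients. -/
theorem pow_mul_ridge_iteratedDeriv_mem (hS : IsClosed (S : Set C(X, ℝ))) {n : ℕ} {f : ℝ → ℝ}
    (hf : ContDiff ℝ n f) (hmem : ∀ l b, ridge ⟨f, hf.continuous⟩ u l b ∈ S) {k : ℕ} (hk : k ≤ n)
    (l b : ℝ) :
    u ^ k * ridge ⟨_, hf.continuous_iteratedDeriv k (by exact_mod_cast hk)⟩ u l b ∈ S := by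
  induction k generalizing l b with
  | zero =>
    convert hmem l b using 1
    ext x
    simp
  | succ k ih =>
    have hk' : k < n := hk
    have hc1 := hf.continuous_iteratedDeriv k (by exact_mod_cast hk'.le)
    have hc2 := hf.continuous_iteratedDeriv (k + 1) (by exact_mod_cast hk)
    have hd (t : ℝ) : HasDerivAt (iteratedDeriv k f) (iteratedDeriv (k + 1) f t) t := by
      rw [iteratedDeriv_succ]
      exact (hf.differentiable_iteratedDeriv k (by exact_mod_cast hk') t).hasDerivAt
    refine mem_of_hasDerivAt hS (hasDerivAt_of_hasDerivAt_apply
      (F := fun l => u ^ k * ridge ⟨_, hc1⟩ u l b)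
      (G := fun l => u ^ (k + 1) * ridge ⟨_, hc2⟩ u l b) ?_ (fun x l => ?_) l)
      fun l => ih hk'.le l b
    · exact continuous_const.mul ((continuous_ridge ⟨_, hc2⟩ u).comp
        (by fun_prop : Continuous fun l : ℝ => (l, b)))
    · have h1 : HasDerivAt (fun l => l * u x + b) (u x) l := by
        simpa using ((hasDerivAt_id l).mul_const (u x)).add_const b
      have h2 := ((hd (l * u x + b)).comp l h1).const_mul (u x ^ k)
      exact h2.congr_deriv (by simp only [ContinuousMap.mul_apply, ContinuousMap.pow_apply,
        ridge_apply, ContinuousMap.coe_mk]; ring)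

theorem pow_mem_of_ridge_mem (hS : IsClosed (S : Set C(X, ℝ))) {σ : ℝ → ℝ}
    (hσ : Continuous σ) (hp : NonPolynomial σ) (hmem : ∀ l b, ridge ⟨σ, hσ⟩ u l b ∈ S) (n : ℕ) :
    u ^ n ∈ S := by
  obtain ⟨h, t, hh, ht⟩ := hp.exists_iteratedDeriv_ne_zero hσ n
  -- At `l = 0` the ridge factor is the constant `iteratedDeriv n _ t`, which is nonzero.
  have := pow_mul_ridge_iteratedDeriv_mem hS (contDiff_iterate_movingAverage hh hσ n)
    (ridge_iterate_movingAverage_mem hS hσ hmem hh n) le_rfl 0 t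
  have h2 := S.smul_mem (iteratedDeriv n ((movingAverage h)^[n] σ) t)⁻¹ this
  convert h2 using 1
  ext x
  simp only [ContinuousMap.pow_apply, ContinuousMap.smul_apply, ContinuousMap.mul_apply,
    ridge_apply, ContinuousMap.coe_mk, zero_mul, zero_add, smul_eq_mul]
  field_simp

theorem exp_mem_of_pow_mem (hS : IsClosed (S : Set C(X, ℝ))) (hu : ∀ n : ℕ, u ^ n ∈ S) :
    (⟨fun x => Real.exp (u x), by fun_prop⟩ : C(X, ℝ)) ∈ S := by
  have e : (⟨fun x => Real.exp (u x), by fun_prop⟩ : C(X, ℝ)) = NormedSpace.exp u := by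
    ext x
    have := NormedSpace.map_exp (ContinuousMap.evalAlgHom ℝ ℝ x)
      (continuous_eval_const x) u
    rw [ContinuousMap.coe_mk, Real.exp_eq_exp_ℝ]
    exact this.symm
  rw [e]
  refine hS.mem_of_tendsto (NormedSpace.exp_series_hasSum_exp' (𝕂 := ℝ) u)
    (Eventually.of_forall fun s => S.sum_mem fun n _ => S.smul_mem _ (hu n))

end Ridge

/-! ### Density of the span of the neurons -/

variable {d : ℕ} {K : Set (Space d)}

/-- The function `x ↦ ⟨w, x⟩` over `K`. -/
def linearFeature (K : Set (Space d)) (w : Space d) : C(K, ℝ) :=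
  ⟨fun x => inner ℝ w x, by fun_prop⟩

/-- The function `x ↦ exp ⟨w, x⟩` over `K`. -/
def expFeature (K : Set (Space d)) (w : Space d) : C(K, ℝ) :=
  ⟨fun x => Real.exp (linearFeature K w x), by fun_prop⟩

/-- The neuron `x ↦ σ (⟨w, x⟩ + b)` over `K`. -/
def neuron {σ : ℝ → ℝ} (hσ : Continuous σ) (K : Set (Space d)) (θ : Space d × ℝ) : C(K, ℝ) :=
  ⟨fun x => σ (inner ℝ θ.1 (x : Space d) + θ.2), by fun_prop⟩

/-- Exponentials of linear forms are closed under products, so the algebra they generate is just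
their span and lies in `S`; Stone-Weierstrass makes it dense. -/
theorem eq_top_of_expFeature_mem [CompactSpace K] {S : Submodule ℝ C(K, ℝ)}
    (hS : IsClosed (S : Set C(K, ℝ))) (h : ∀ w, expFeature K w ∈ S) : S = ⊤ := by
  let M : Submonoid C(K, ℝ) :=
    { carrier := Set.range (expFeature K)
      one_mem' := ⟨0, by ext x; simp [expFeature, linearFeature]⟩
      mul_mem' := by
        rintro _ _ ⟨v, rfl⟩ ⟨w, rfl⟩
        exact ⟨v + w, by ext x; simp [expFeature, linearFeature, inner_add_left, Real.exp_add]⟩ }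
  let A : Subalgebra ℝ C(K, ℝ) := Algebra.adjoin ℝ (M : Set C(K, ℝ))
  have hA : Subalgebra.toSubmodule A ≤ S := by
    rw [Algebra.adjoin_eq_span, Submonoid.closure_eq, Submodule.span_le]
    rintro _ ⟨w, rfl⟩
    exact h w
  have hsep : A.SeparatesPoints := by
    intro x y hxy
    -- The direction `x - y` separates `x` from `y`: equal values would force `‖x - y‖ ^ 2 = 0`.
    refine ⟨_, ⟨expFeature K ((x : Space d) - y), Algebra.subset_adjoin ⟨_, rfl⟩, rfl⟩, ?_⟩
    intro he
    have h1 : inner ℝ ((x : Space d) - y) (x : Space d) =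
        inner ℝ ((x : Space d) - y) (y : Space d) :=
      Real.exp_injective he
    rw [← sub_eq_zero, ← inner_sub_right, inner_self_eq_zero, sub_eq_zero] at h1
    exact hxy (Subtype.ext h1)
  have htop := ContinuousMap.subalgebra_topologicalClosure_eq_top_of_separatesPoints A hsep
  refine eq_top_iff.2 fun f _ => ?_
  have hf : f ∈ A.topologicalClosure := htop ▸ Algebra.mem_top
  exact closure_minimal (fun g hg => hA hg) hS hf

theorem topologicalClosure_span_neuron_eq_top [CompactSpace K] {σ : ℝ → ℝ} (hσ : Continuous σ)
    (hp : NonPolynomial σ) :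
    (Submodule.span ℝ (Set.range (neuron hσ K))).topologicalClosure = ⊤ := by
  have hS := (Submodule.span ℝ (Set.range (neuron hσ K))).isClosed_topologicalClosure
  refine eq_top_of_expFeature_mem hS fun w => exp_mem_of_pow_mem hS fun n =>
    pow_mem_of_ridge_mem hS hσ hp (fun l b => ?_) n
  refine Submodule.le_topologicalClosure _ (Submodule.subset_span ⟨(l • w, b), ?_⟩)
  ext x
  simp [neuron, linearFeature, inner_smul_left]

theorem dense_of_neuron_mem [CompactSpace K] {σ : ℝ → ℝ} (hσ : Continuous σ)
    (hp : NonPolynomial σ) {S : Submodule ℝ C(K, ℝ)}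
    (h : ∀ θ, neuron hσ K θ ∈ S.topologicalClosure) : Dense (S : Set C(K, ℝ)) := by
  rw [Submodule.dense_iff_topologicalClosure_eq_top, eq_top_iff,
    ← topologicalClosure_span_neuron_eq_top hσ hp]
  refine Submodule.topologicalClosure_minimal _ (Submodule.span_le.2 ?_)
    S.isClosed_topologicalClosure
  rintro _ ⟨θ, rfl⟩
  exact h θ

/-! ### Density of the Barron space -/

theorem span_neuron_subset_barronSpace {σ : ℝ → ℝ} (hσ : Continuous σ) :
    (Submodule.span ℝ (Set.range (neuron hσ K)) : Set C(K, ℝ)) ⊆ barronSpace σ K := by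
  intro V hV
  obtain ⟨c, rfl⟩ := (Finsupp.mem_span_range_iff_exists_finsupp).1 hV
  -- The extra unit is for an atom at the origin, whose output weight `a = 0` contributes nothing;
  -- it keeps `ρ` a probability measure even when `c = 0`. The outer weights are scaled by `N` to
  -- undo the normalization.
  set N : ℝ := c.support.card + 1 with hN
  have hN0 : 0 < N := by positivity
  set ρ : Measure (ℝ × Space d × ℝ) := ENNReal.ofReal N⁻¹ •
    (Measure.dirac 0 + ∑ θ ∈ c.support, Measure.dirac (N * c θ, θ)) with hρ
  have hprob : IsProbabilityMeasure ρ := by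
    constructor
    have : (1 : ℝ≥0∞) + c.support.card = ENNReal.ofReal N := by
      rw [hN, ENNReal.ofReal_add (by positivity) zero_le_one, ENNReal.ofReal_natCast,
        ENNReal.ofReal_one, add_comm]
    simp only [hρ, Measure.smul_apply, Measure.add_apply, Measure.finsetSum_apply, measure_univ,
      Finset.sum_const, nsmul_eq_mul, mul_one, smul_eq_mul]
    rw [this, ← ENNReal.ofReal_mul (by positivity), inv_mul_cancel₀ hN0.ne', ENNReal.ofReal_one]
  have hint (g : ℝ × Space d × ℝ → ℝ) : Integrable g ρ ∧
      ∫ θ, g θ ∂ρ = N⁻¹ * (g 0 + ∑ θ ∈ c.support, g (N * c θ, θ)) := by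
    have h1 : ∀ θ ∈ c.support, Integrable g (Measure.dirac (N * c θ, θ)) :=
      fun θ _ => integrable_dirac (by simp)
    have h2 : Integrable g (∑ θ ∈ c.support, Measure.dirac (N * c θ, θ)) :=
      integrable_finsetSum_measure.2 h1
    have h3 : Integrable g (Measure.dirac (0 : ℝ × Space d × ℝ)) := integrable_dirac (by simp)
    refine ⟨(h3.add_measure h2).smul_measure ENNReal.ofReal_ne_top, ?_⟩
    rw [hρ, integral_smul_measure, integral_add_measure h3 h2, integral_finsetSum_measure h1,
      ENNReal.toReal_ofReal (by positivity)]
    simp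
  refine ⟨fun x => ∫ θ, θ.1 * σ (inner ℝ θ.2.1 x + θ.2.2) ∂ρ, ?_, fun x => ?_⟩
  · refine (iInf₂_le_of_le ρ hprob (iInf_le_of_le (fun x => ⟨(hint _).1, rfl⟩) le_rfl)).trans_lt ?_
    exact ENNReal.rpow_lt_top_of_nonneg (by norm_num)
      ((hint fun θ => θ.1 ^ 2 * (‖θ.2.1‖ ^ 2 + θ.2.2 ^ 2)).1.lintegral_lt_top.ne)
  · beta_reduce
    rw [(hint _).2, Finsupp.sum]
    simp only [Prod.fst_zero, zero_mul, zero_add, Finset.mul_sum, ContinuousMap.sum_apply,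
      ContinuousMap.smul_apply, smul_eq_mul]
    refine Finset.sum_congr rfl fun θ _ => ?_
    rw [mul_assoc, inv_mul_cancel_left₀ hN0.ne']
    rfl

theorem dense_barronSpace (hK : IsCompact K) {σ : ℝ → ℝ} (hσ : Continuous σ)
    (hp : NonPolynomial σ) : Dense (barronSpace σ K) := by
  have : CompactSpace K := isCompact_iff_compactSpace.1 hK
  exact Dense.mono (span_neuron_subset_barronSpace hσ) (dense_of_neuron_mem hσ hp fun θ =>
    Submodule.le_topologicalClosure _ (Submodule.subset_span ⟨θ, rfl⟩))

/-! ### Density of the RKHS -/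

theorem continuous_neuron {σ : ℝ → ℝ} (hσ : Continuous σ) : Continuous (neuron hσ K) := by
  refine ContinuousMap.continuous_of_continuous_uncurry _ ?_
  simp only [Function.uncurry_def, neuron, ContinuousMap.coe_mk]
  fun_prop

/-- The random feature functions over `K` with square integrable coefficient functions. -/
def randomFeatureSubmodule (σ : ℝ → ℝ) (ρ₀ : Measure (Space d × ℝ)) (K : Set (Space d)) :
    Submodule ℝ C(K, ℝ) where
  carrier := {V | ∃ a : Space d × ℝ → ℝ, MemLp a 2 ρ₀ ∧
    (∀ x : Space d, Integrable (fun θ : Space d × ℝ => a θ * σ (inner ℝ θ.1 x + θ.2)) ρ₀) ∧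
    ∀ x : K, V x = ∫ θ, a θ * σ (inner ℝ θ.1 (x : Space d) + θ.2) ∂ρ₀}
  zero_mem' := ⟨0, MemLp.zero, by simp, by simp⟩
  add_mem' := by
    rintro V W ⟨a, ha, hai, haV⟩ ⟨b, hb, hbi, hbW⟩
    refine ⟨a + b, ha.add hb, fun x => ?_, fun x => ?_⟩
    · simp only [Pi.add_apply, add_mul]
      exact (hai x).add (hbi x)
    · simp only [Pi.add_apply, add_mul, ContinuousMap.add_apply]
      rw [integral_add (hai x) (hbi x), haV, hbW]
  smul_mem' := by
    rintro c V ⟨a, ha, hai, haV⟩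
    refine ⟨c • a, ha.const_smul c, fun x => ?_, fun x => ?_⟩
    · simp only [Pi.smul_apply, smul_eq_mul, mul_assoc]
      exact (hai x).const_mul c
    · simp only [Pi.smul_apply, smul_eq_mul, mul_assoc, ContinuousMap.smul_apply]
      rw [integral_const_mul, haV]

theorem randomFeatureSubmodule_subset_rkhsSpace (σ : ℝ → ℝ) (ρ₀ : Measure (Space d × ℝ)) :
    (randomFeatureSubmodule σ ρ₀ K : Set C(K, ℝ)) ⊆ rkhsSpace σ ρ₀ K := by
  rintro V ⟨a, ha, hai, haV⟩
  refine ⟨fun x => ∫ θ, a θ * σ (inner ℝ θ.1 x + θ.2) ∂ρ₀, ?_, haV⟩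
  exact (iInf₂_le_of_le a ha.1 (iInf_le_of_le (fun x => ⟨hai x, rfl⟩) le_rfl)).trans_lt ha.2

/-- A ball around a support point has positive mass, and the average of the neurons over it is a
random feature function whose coefficient is the normalized indicator of the ball. By continuity in
the parameters this average is close to the central neuron. -/
theorem neuron_mem_closure_randomFeatureSubmodule [CompactSpace K] {σ : ℝ → ℝ} (hσ : Continuous σ)
    {ρ₀ : Measure (Space d × ℝ)} [IsFiniteMeasure ρ₀] {θ₀ : Space d × ℝ} (hθ₀ : θ₀ ∈ ρ₀.support) :
    neuron hσ K θ₀ ∈ (randomFeatureSubmodule σ ρ₀ K).topologicalClosure := by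
  refine Metric.mem_closure_iff.2 fun ε hε => ?_
  obtain ⟨r, hr, hrε⟩ := Metric.continuous_iff.1 (continuous_neuron (K := K) hσ) θ₀ (ε / 2)
    (half_pos hε)
  set B := Metric.closedBall θ₀ (r / 2) with hB
  have hBmeas : MeasurableSet B := Metric.isClosed_closedBall.measurableSet
  have hBpos : 0 < ρ₀ B := (Measure.mem_support_iff_forall θ₀).1 hθ₀ B
    (Metric.closedBall_mem_nhds θ₀ (half_pos hr))
  have hBcomp : IsCompact B := isCompact_closedBall θ₀ (r / 2)
  have hint : IntegrableOn (neuron hσ K) B ρ₀ :=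
    (continuous_neuron hσ).continuousOn.integrableOn_compact hBcomp
  refine ⟨⨍ θ in B, neuron hσ K θ ∂ρ₀, ⟨B.indicator fun _ => (ρ₀.real B)⁻¹, ?_, fun x => ?_,
    fun x => ?_⟩, ?_⟩
  · exact memLp_indicator_const 2 hBmeas _ (Or.inr (measure_ne_top _ _))
  · have : (fun θ : Space d × ℝ => B.indicator (fun _ => (ρ₀.real B)⁻¹) θ *
        σ (inner ℝ θ.1 x + θ.2)) =
        B.indicator fun θ => (ρ₀.real B)⁻¹ * σ (inner ℝ θ.1 x + θ.2) := by
      funext θ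
      by_cases h : θ ∈ B <;> simp [h]
    rw [this, integrable_indicator_iff hBmeas]
    exact (by fun_prop : Continuous fun θ : Space d × ℝ =>
      (ρ₀.real B)⁻¹ * σ (inner ℝ θ.1 x + θ.2)).continuousOn.integrableOn_compact hBcomp
  · have : (fun θ : Space d × ℝ => B.indicator (fun _ => (ρ₀.real B)⁻¹) θ *
        σ (inner ℝ θ.1 (x : Space d) + θ.2)) =
        B.indicator fun θ => (ρ₀.real B)⁻¹ * σ (inner ℝ θ.1 (x : Space d) + θ.2) := by
      funext θ
      by_cases h : θ ∈ B <;> simp [h]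
    rw [this, integral_indicator hBmeas, integral_const_mul, setAverage_eq,
      ContinuousMap.smul_apply, smul_eq_mul]
    congr 1
    exact ((ContinuousMap.evalCLM ℝ x).integral_comp_comm hint).symm
  · have hmem : (⨍ θ in B, neuron hσ K θ ∂ρ₀) ∈ Metric.closedBall (neuron hσ K θ₀) (ε / 2) := by
      refine (convex_closedBall _ _).set_average_mem Metric.isClosed_closedBall hBpos.ne'
        (measure_ne_top _ _) ?_ hint
      filter_upwards [ae_restrict_mem hBmeas] with θ hθ
      exact (hrε θ ((Metric.mem_closedBall.1 hθ).trans_lt (half_lt_self hr))).le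
    rw [dist_comm]
    exact (Metric.mem_closedBall.1 hmem).trans_lt (half_lt_self hε)

theorem continuous_relu : Continuous relu := by
  unfold relu
  fun_prop

theorem nonPolynomial_relu : NonPolynomial relu := by
  rintro ⟨q, hq⟩
  have h0 : q = 0 := Polynomial.eq_zero_of_infinite_isRoot q <|
    (Set.Iic_infinite (0 : ℝ)).mono fun t ht => by
      rw [Set.mem_ofPred_eq, Polynomial.IsRoot, ← hq]
      exact max_eq_right ht
  have h1 := hq 1
  simp [h0, relu] at h1

/-- Homogeneity is what lets one support point per direction suffice for ReLU. -/
theorem neuron_relu_smul {c : ℝ} (hc : 0 ≤ c) (θ : Space d × ℝ) :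
    neuron continuous_relu K (c • θ) = c • neuron continuous_relu K θ := by
  ext x
  simp only [neuron, relu, ContinuousMap.coe_mk, ContinuousMap.smul_apply, Prod.smul_fst,
    Prod.smul_snd, real_inner_smul_left, smul_eq_mul, ← mul_add]
  rw [mul_max_of_nonneg _ _ hc, mul_zero]

theorem dense_rkhsSpace (hK : IsCompact K) {σ : ℝ → ℝ} {ρ₀ : Measure (Space d × ℝ)}
    [IsProbabilityMeasure ρ₀] (h : RandomFeatureAssumption σ ρ₀) :
    Dense (rkhsSpace σ ρ₀ K) := by
  have : CompactSpace K := isCompact_iff_compactSpace.1 hK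
  refine Dense.mono (randomFeatureSubmodule_subset_rkhsSpace σ ρ₀) ?_
  rcases h with ⟨hσ, hp, -, hsupp⟩ | ⟨rfl, hcov⟩
  · refine dense_of_neuron_mem hσ hp fun θ =>
      neuron_mem_closure_randomFeatureSubmodule hσ ?_
    rw [hsupp]
    trivial
  · refine dense_of_neuron_mem continuous_relu nonPolynomial_relu fun θ => ?_
    by_cases hθ : θ = 0
    · have : neuron continuous_relu K θ = 0 := by
        ext x
        simp [neuron, relu, hθ]
      rw [this]
      exact Submodule.zero_mem _
    · obtain ⟨c, hc, hcθ⟩ := hcov θ hθ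
      have h1 := Submodule.smul_mem _ c⁻¹
        (neuron_mem_closure_randomFeatureSubmodule (K := K) continuous_relu hcθ)
      rwa [neuron_relu_smul hc.le, inv_smul_smul₀ hc.ne'] at h1

/-! ### Bounds for the distances between probability measures -/

/-- By the Hahn decomposition the positive and negative parts are values of the difference on a set
and, up to sign, on its complement; each costs `η`, hence the factor `2`. -/
theorem tvDist_le {X : Type*} [MeasurableSpace X] {μ ν : Measure X} [IsFiniteMeasure μ]
    [IsFiniteMeasure ν] {η : ℝ} (h : ∀ s, MeasurableSet s → |μ.real s - ν.real s| ≤ η) :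
    tvDist μ ν ≤ ENNReal.ofReal (2 * η) := by
  obtain ⟨i, hi₁, hi₂, hi₃, hp, hn⟩ :=
    (μ.toSignedMeasure - ν.toSignedMeasure).toJordanDecomposition_spec
  have hi := abs_le.1 (h i hi₁)
  have hi' := abs_le.1 (h iᶜ hi₁.compl)
  have h0 : 0 ≤ η := (abs_nonneg _).trans (h ∅ MeasurableSet.empty)
  unfold tvDist SignedMeasure.totalVariation
  rw [Measure.add_apply, hp, hn, two_mul, ENNReal.ofReal_add h0 h0]
  gcongr
  · rw [← ENNReal.ofReal_toReal (measure_ne_top _ _), ← measureReal_def,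
      SignedMeasure.toMeasureOfZeroLE_real_apply _ hi₂ hi₁ MeasurableSet.univ, Set.inter_univ,
      Measure.toSignedMeasure_sub_apply hi₁]
    exact ENNReal.ofReal_le_ofReal hi.2
  · rw [← ENNReal.ofReal_toReal (measure_ne_top _ _), ← measureReal_def,
      SignedMeasure.toMeasureOfLEZero_real_apply _ hi₃ hi₁.compl MeasurableSet.univ, Set.inter_univ,
      Measure.toSignedMeasure_sub_apply hi₁.compl]
    exact ENNReal.ofReal_le_ofReal (by linarith [hi'.1])

/-- Domination on `s` bounds the difference from one side; domination on the complement gives the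
other, as both measures have mass `1`. -/
theorem abs_real_sub_real_le_of_smul_le {X : Type*} [MeasurableSpace X] {μ ν : Measure X}
    [IsProbabilityMeasure μ] [IsProbabilityMeasure ν] {c : ℝ} (hc0 : 0 ≤ c) (hc1 : c ≤ 1)
    (h : ENNReal.ofReal c • μ ≤ ν) {s : Set X} (hs : MeasurableSet s) :
    |μ.real s - ν.real s| ≤ 1 - c := by
  have key (t : Set X) : c * μ.real t ≤ ν.real t := by
    have := ENNReal.toReal_mono (measure_ne_top ν t) (h t)
    simpa [measureReal_def, ENNReal.toReal_ofReal hc0] using this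
  have h1 := key s
  have h2 := key sᶜ
  rw [probReal_compl_eq_one_sub hs, probReal_compl_eq_one_sub hs] at h2
  have h3 : μ.real s ≤ 1 := measureReal_le_one
  have h4 : 0 ≤ μ.real s := measureReal_nonneg
  rw [abs_le]
  constructor <;> nlinarith

/-- The density of `μ` is at most `C` almost everywhere, so its logarithm integrates against `μ` to
at most `log C`. -/
theorem klDiv_le_of_le_smul {X : Type*} [MeasurableSpace X] {μ ν : Measure X}
    [IsProbabilityMeasure μ] [IsProbabilityMeasure ν] {C : ℝ} (hC : 0 < C)
    (h : μ ≤ ENNReal.ofReal C • ν) :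
    InformationTheory.klDiv μ ν ≤ ENNReal.ofReal (Real.log C) := by
  have hac : μ ≪ ν := (Measure.absolutelyContinuous_of_le h).trans
    (Measure.smul_absolutelyContinuous)
  have hle : ∀ᵐ x ∂ν, μ.rnDeriv ν x ≤ ENNReal.ofReal C := by
    refine ae_le_of_forall_setLIntegral_le_of_sigmaFinite (Measure.measurable_rnDeriv _ _)
      fun s _ _ => ?_
    rw [setLIntegral_const]
    exact (Measure.setLIntegral_rnDeriv_le s).trans (h s)
  have hint : Integrable (fun x => (μ.rnDeriv ν x).toReal) ν := Measure.integrable_toReal_rnDeriv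
  have hkl : ∀ᵐ x ∂ν, InformationTheory.klFun (μ.rnDeriv ν x).toReal ≤
      (μ.rnDeriv ν x).toReal * Real.log C + 1 - (μ.rnDeriv ν x).toReal := by
    filter_upwards [hle] with x hx
    have hx' : (μ.rnDeriv ν x).toReal ≤ C := ENNReal.toReal_le_of_le_ofReal hC.le hx
    have h0 : 0 ≤ (μ.rnDeriv ν x).toReal := ENNReal.toReal_nonneg
    unfold InformationTheory.klFun
    rcases h0.eq_or_lt with h0 | h0
    · simp [← h0]
    · gcongr
  have hint₁ : Integrable (fun x => (μ.rnDeriv ν x).toReal * Real.log C + 1) ν :=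
    (hint.mul_const _).add (integrable_const _)
  have hint₂ : Integrable (fun x => (μ.rnDeriv ν x).toReal * Real.log C + 1 -
      (μ.rnDeriv ν x).toReal) ν := hint₁.sub hint
  rw [InformationTheory.klDiv_eq_lintegral_klFun_of_ac hac]
  calc ∫⁻ x, ENNReal.ofReal (InformationTheory.klFun (μ.rnDeriv ν x).toReal) ∂ν
      ≤ ∫⁻ x, ENNReal.ofReal ((μ.rnDeriv ν x).toReal * Real.log C + 1
          - (μ.rnDeriv ν x).toReal) ∂ν :=
        lintegral_mono_ae (hkl.mono fun x hx => ENNReal.ofReal_le_ofReal hx)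
    _ = ENNReal.ofReal (Real.log C) := by
        rw [← ofReal_integral_eq_lintegral_ofReal hint₂
          (hkl.mono fun x hx => (InformationTheory.klFun_nonneg ENNReal.toReal_nonneg).trans hx),
          integral_sub hint₁ hint, integral_add (hint.mul_const _) (integrable_const _),
          integral_mul_const, Measure.integral_toReal_rnDeriv hac]
        simp

theorem wasserstein_rpow_le {X : Type*} [MeasurableSpace X] [PseudoEMetricSpace X] {p : ℝ}
    (hp : 0 < p) {μ ν : Measure X} {π : Measure (X × X)} (hπ : IsCoupling π μ ν) :
    wasserstein p μ ν ^ p ≤ ∫⁻ z, edist z.1 z.2 ^ p ∂π := by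
  rw [wasserstein, ← ENNReal.rpow_mul, one_div_mul_cancel hp.ne', ENNReal.rpow_one]
  exact iInf₂_le π hπ

/-- If `c • μ' ≤ ν`, then a coupling of `μ` and `μ'` with cost `A` gives a coupling of `μ` and `ν`
that transports a proportion `c` of the mass at cost `A`. -/
theorem wasserstein_rpow_le_of_smul_le {X : Type*} [MeasurableSpace X] [PseudoEMetricSpace X]
    {p : ℝ} (hp : 0 < p) {μ μ' ν : Measure X} [IsProbabilityMeasure μ] [IsProbabilityMeasure μ']
    [IsProbabilityMeasure ν] {π : Measure (X × X)} (hπ : IsCoupling π μ μ') {A B c : ℝ≥0∞}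
    (hA : ∫⁻ z, edist z.1 z.2 ^ p ∂π ≤ A) (hB : ∀ x y : X, edist x y ^ p ≤ B) (hc : c ≤ 1)
    (h : c • μ' ≤ ν) : wasserstein p μ ν ^ p ≤ c * A + B * (1 - c) := by
  have hfin : IsFiniteMeasure (c • μ') := isFiniteMeasure_of_le ν h
  have huniv : (ν - c • μ') Set.univ = 1 - c := by
    rw [Measure.sub_apply MeasurableSet.univ h]
    simp
  -- The part `c • μ'` of `ν` keeps the given coupling; the remainder, of mass `1 - c`, is coupled
  -- independently with `μ`.
  have hcoup : IsCoupling (c • π + μ.prod (ν - c • μ')) μ ν := by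
    refine ⟨?_, ?_⟩
    · rw [Measure.map_add _ _ measurable_fst, Measure.map_smul, hπ.1, Measure.map_fst_prod, huniv,
        ← add_smul, add_tsub_cancel_of_le hc, one_smul]
    · rw [Measure.map_add _ _ measurable_snd, Measure.map_smul, hπ.2, Measure.map_snd_prod,
        measure_univ, one_smul, add_comm, Measure.sub_add_cancel_of_le h]
  refine (wasserstein_rpow_le hp hcoup).trans ?_
  rw [lintegral_add_measure, lintegral_smul_measure, smul_eq_mul]
  gcongr
  calc ∫⁻ z, edist z.1 z.2 ^ p ∂(μ.prod (ν - c • μ'))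
      ≤ ∫⁻ _, B ∂(μ.prod (ν - c • μ')) := lintegral_mono fun z => hB z.1 z.2
    _ = B * (1 - c) := by
        rw [lintegral_const, ← Set.univ_prod_univ, Measure.prod_prod, huniv, measure_univ, one_mul]

/-! ### Smoothing a measure by bump functions -/

section Smoothing

variable {X : Type*} [MetricSpace X] [CompactSpace X] [MeasurableSpace X] [BorelSpace X]

theorem continuous_integral_of_continuous_uncurry {k : X → X → ℝ} (hk : Continuous k.uncurry)
    (μ : Measure X) [IsFiniteMeasure μ] : Continuous fun x => ∫ y, k x y ∂μ := by
  simpa using continuous_parametric_integral_of_continuous (μ := μ) hk isCompact_univ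

/-- The kernel `k(x, y) = max (δ - dist x y) 0 / N(x)`, normalized on the support of `P`. -/
theorem exists_bump_kernel (P : Measure X) [IsProbabilityMeasure P] {δ : ℝ} (hδ : 0 < δ) :
    ∃ k : X → X → ℝ, Continuous k.uncurry ∧ (∀ x y, 0 ≤ k x y) ∧
      (∀ x y, δ ≤ dist x y → k x y = 0) ∧ ∀ x ∈ P.support, ∫ y, k x y ∂P = 1 := by
  set φ : X → X → ℝ := fun x y => max (δ - dist x y) 0 with hφ
  have hφc : Continuous φ.uncurry := by
    simp only [hφ, Function.uncurry_def]
    fun_prop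
  set N : X → ℝ := fun x => ∫ y, φ x y ∂P with hN
  have hNc : Continuous N := continuous_integral_of_continuous_uncurry hφc P
  have hφ0 (x y : X) : 0 ≤ φ x y := le_max_right _ _
  have hNpos : ∀ x ∈ P.support, 0 < N x := by
    intro x hx
    have hφx : Continuous (φ x) := hφc.comp (by fun_prop : Continuous fun y => (x, y))
    refine (integral_pos_iff_support_of_nonneg (hφ0 x)
      (hφx.integrable_of_hasCompactSupport (HasCompactSupport.of_compactSpace _))).2 ?_
    refine (Measure.mem_support_iff_forall x).1 hx _ (mem_of_superset (Metric.ball_mem_nhds x hδ) ?_)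
    intro y hy
    rw [Function.mem_support]
    refine (lt_max_of_lt_left ?_).ne'
    rw [dist_comm]
    exact sub_pos.2 hy
  -- The normalizer `N` may vanish off the support of `P`. It has a positive minimum `N x₀` on this
  -- compact set, and dividing by `max (N x) (N x₀)` keeps the kernel continuous everywhere and
  -- changes nothing on the support.
  obtain ⟨x₀, hx₀, hmin⟩ := Measure.isClosed_support.isCompact.exists_isMinOn
    (Measure.nonempty_support (IsProbabilityMeasure.ne_zero P)) hNc.continuousOn
  have hm : 0 < N x₀ := hNpos x₀ hx₀
  have hpos (x : X) : 0 < max (N x) (N x₀) := lt_max_of_lt_right hm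
  refine ⟨fun x y => φ x y / max (N x) (N x₀), ?_, fun x y => div_nonneg (hφ0 x y) (hpos x).le,
    fun x y hxy => ?_, fun x hx => ?_⟩
  · simp only [Function.uncurry_def]
    exact hφc.div (by fun_prop) fun z => (hpos z.1).ne'
  · simp only [hφ]
    rw [max_eq_right (sub_nonpos.2 hxy), zero_div]
  · rw [integral_div, max_eq_left (hmin hx)]
    exact div_self (hNpos x hx).ne'

/-- A probability measure supported in the support of `P` is coupled, at distance at most `δ`, with
one that has a continuous density with respect to `P`. -/
theorem exists_coupling_continuous_density {P Q : Measure X} [IsProbabilityMeasure P]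
    [IsProbabilityMeasure Q] (hsupp : Q.support ⊆ P.support) {δ : ℝ} (hδ : 0 < δ) {p : ℝ}
    (hp : 0 < p) :
    ∃ (f : C(X, ℝ)) (π : Measure (X × X)), (∀ x, 0 ≤ f x) ∧
      IsProbabilityMeasure (P.withDensity fun x => ENNReal.ofReal (f x)) ∧
      IsCoupling π Q (P.withDensity fun x => ENNReal.ofReal (f x)) ∧
      ∫⁻ z, edist z.1 z.2 ^ p ∂π ≤ ENNReal.ofReal δ ^ p := by
  obtain ⟨k, hk, hk0, hkδ, hk1⟩ := exists_bump_kernel P hδ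
  have hkswap : Continuous (fun y x => k x y).uncurry := hk.comp continuous_swap
  have hkx (x : X) : Continuous (k x) := hk.comp (by fun_prop : Continuous fun y => (x, y))
  have hky (y : X) : Continuous fun x => k x y := hk.comp (by fun_prop : Continuous fun x => (x, y))
  have hmeas : Measurable fun z : X × X => ENNReal.ofReal (k z.1 z.2) :=
    hk.measurable.ennreal_ofReal
  set f : C(X, ℝ) := ⟨fun y => ∫ x, k x y ∂Q, continuous_integral_of_continuous_uncurry hkswap Q⟩
    with hf
  -- Integrating out the second variable returns `Q`, because `k` is normalized on the support of
  -- `P` and `Q` lives there; integrating out the first gives density `f`.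
  set π : Measure (X × X) := (Q.prod P).withDensity fun z => ENNReal.ofReal (k z.1 z.2) with hπ
  have hfst : π.map Prod.fst = Q := by
    ext s hs
    have e : Prod.fst ⁻¹' s = s ×ˢ (Set.univ : Set X) := by ext; simp
    rw [Measure.map_apply measurable_fst hs, hπ, withDensity_apply _ (measurable_fst hs), e,
      setLIntegral_prod _ hmeas.aemeasurable]
    rw [← setLIntegral_one s]
    refine setLIntegral_congr_fun_ae hs ?_
    filter_upwards [Measure.support_mem_ae (μ := Q)] with x hx _
    rw [Measure.restrict_univ, ← ofReal_integral_eq_lintegral_ofReal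
      ((hkx x).integrable_of_hasCompactSupport (HasCompactSupport.of_compactSpace _))
      (Eventually.of_forall (hk0 x)), hk1 x (hsupp hx), ENNReal.ofReal_one]
  have hsnd : π.map Prod.snd = P.withDensity fun x => ENNReal.ofReal (f x) := by
    ext s hs
    have e : Prod.snd ⁻¹' s = (Set.univ : Set X) ×ˢ s := by ext; simp
    rw [Measure.map_apply measurable_snd hs, hπ, withDensity_apply _ (measurable_snd hs), e,
      setLIntegral_prod_symm _ hmeas.aemeasurable, withDensity_apply _ hs]
    refine setLIntegral_congr_fun hs fun y _ => ?_
    rw [Measure.restrict_univ, hf, ContinuousMap.coe_mk, ofReal_integral_eq_lintegral_ofReal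
      ((hky y).integrable_of_hasCompactSupport (HasCompactSupport.of_compactSpace _))
      (Eventually.of_forall fun x => hk0 x y)]
  have hπprob : IsProbabilityMeasure π := by
    constructor
    rw [← Set.preimage_univ (f := Prod.fst), ← Measure.map_apply measurable_fst MeasurableSet.univ,
      hfst, measure_univ]
  refine ⟨f, π, fun y => integral_nonneg fun x => hk0 x y, ?_, ⟨hfst, hsnd⟩, ?_⟩
  · rw [← hsnd]
    exact Measure.isProbabilityMeasure_map measurable_snd.aemeasurable
  · rw [hπ, lintegral_withDensity_eq_lintegral_mul _ hmeas
      (measurable_edist.pow_const p)]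
    calc ∫⁻ z, ((fun z : X × X => ENNReal.ofReal (k z.1 z.2)) *
          fun z : X × X => edist z.1 z.2 ^ p) z ∂(Q.prod P)
        ≤ ∫⁻ z, ENNReal.ofReal δ ^ p * ENNReal.ofReal (k z.1 z.2) ∂(Q.prod P) := by
          refine lintegral_mono fun z => ?_
          simp only [Pi.mul_apply]
          rcases le_or_gt δ (dist z.1 z.2) with h | h
          · simp [hkδ _ _ h]
          · rw [mul_comm, edist_dist]
            gcongr
      _ = ENNReal.ofReal δ ^ p * π Set.univ := by
          rw [lintegral_const_mul _ hmeas, hπ, withDensity_apply _ MeasurableSet.univ,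
            Measure.restrict_univ]
      _ = ENNReal.ofReal δ ^ p := by rw [measure_univ, mul_one]

end Smoothing

/-! ### Boltzmann distributions -/

theorem lebesgue_univ (hK : IsCompact K) : lebesgue K Set.univ = volume K := by
  rw [lebesgue, comap_subtype_coe_apply hK.measurableSet]
  simp

theorem lebesgue_univ_ne_zero (hK : IsCompact K) (hvol : 0 < volume K) :
    lebesgue K Set.univ ≠ 0 := lebesgue_univ hK ▸ hvol.ne'

theorem lebesgue_univ_ne_top (hK : IsCompact K) : lebesgue K Set.univ ≠ ∞ :=
  lebesgue_univ hK ▸ hK.measure_lt_top.ne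

theorem isProbabilityMeasure_uniform (hK : IsCompact K) (hvol : 0 < volume K) :
    IsProbabilityMeasure (uniform K) := by
  refine ⟨?_⟩
  rw [uniform, Measure.smul_apply, smul_eq_mul]
  exact ENNReal.inv_mul_cancel (lebesgue_univ_ne_zero hK hvol) (lebesgue_univ_ne_top hK)

theorem lebesgue_eq_smul_uniform (hK : IsCompact K) (hvol : 0 < volume K) :
    lebesgue K = lebesgue K Set.univ • uniform K := by
  rw [uniform, smul_smul, ENNReal.mul_inv_cancel (lebesgue_univ_ne_zero hK hvol)
    (lebesgue_univ_ne_top hK), one_smul]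

theorem integrable_of_continuous {X : Type*} [TopologicalSpace X] [CompactSpace X]
    [MeasurableSpace X] [OpensMeasurableSpace X] {μ : Measure X} [IsFiniteMeasure μ] {f : X → ℝ}
    (hf : Continuous f) : Integrable f μ :=
  hf.integrable_of_hasCompactSupport (HasCompactSupport.of_compactSpace f)

theorem isProbabilityMeasure_boltzmann (hK : IsCompact K) (hvol : 0 < volume K) (V : C(K, ℝ)) :
    IsProbabilityMeasure (boltzmann K V) := by
  have : CompactSpace K := isCompact_iff_compactSpace.1 hK
  have := isProbabilityMeasure_uniform hK hvol
  have h : boltzmann K V = (uniform K).tilted fun x => -V x := by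
    unfold boltzmann Measure.tilted
    simp only [div_eq_inv_mul]
  rw [h]
  exact isProbabilityMeasure_tilted (integrable_of_continuous (by fun_prop))

theorem hasContinuousDensity_boltzmann (hK : IsCompact K) (hvol : 0 < volume K) (V : C(K, ℝ)) :
    HasContinuousDensity (boltzmann K V) := by
  refine ⟨⟨fun x => (lebesgue K Set.univ).toReal⁻¹ *
    ((∫ y, Real.exp (-V y) ∂(uniform K))⁻¹ * Real.exp (-V x)), by fun_prop⟩, fun x => ?_, ?_⟩
  · have : 0 ≤ ∫ y, Real.exp (-V y) ∂(uniform K) := integral_nonneg fun y => (Real.exp_pos _).le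
    rw [ContinuousMap.coe_mk]
    positivity
  · rw [boltzmann]
    nth_rewrite 1 [uniform]
    rw [withDensity_smul_measure, ← withDensity_smul' _ _
      (ENNReal.inv_ne_top.2 (lebesgue_univ_ne_zero hK hvol))]
    congr 1
    funext x
    change _ = ENNReal.ofReal ((lebesgue K Set.univ).toReal⁻¹ *
      ((∫ y, Real.exp (-V y) ∂(uniform K))⁻¹ * Real.exp (-V x)))
    rw [Pi.smul_apply, smul_eq_mul, ENNReal.ofReal_mul (inv_nonneg.2 ENNReal.toReal_nonneg),
      ← ENNReal.toReal_inv, ENNReal.ofReal_toReal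
        (ENNReal.inv_ne_top.2 (lebesgue_univ_ne_zero hK hvol))]

theorem HasContinuousDensity.exists_uniform_withDensity (hK : IsCompact K) (hvol : 0 < volume K)
    {Q : Measure K} (hQ : HasContinuousDensity Q) : ∃ f : C(K, ℝ), (∀ x, 0 ≤ f x) ∧
      Q = (uniform K).withDensity fun x => ENNReal.ofReal (f x) := by
  obtain ⟨f, hf, rfl⟩ := hQ
  refine ⟨(lebesgue K Set.univ).toReal • f, fun x => mul_nonneg ENNReal.toReal_nonneg (hf x), ?_⟩
  have htop := lebesgue_univ_ne_top hK
  conv_lhs => rw [lebesgue_eq_smul_uniform hK hvol]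
  rw [withDensity_smul_measure, ← withDensity_smul' _ _ htop]
  congr 1
  funext x
  rw [Pi.smul_apply, smul_eq_mul, ContinuousMap.smul_apply, smul_eq_mul,
    ENNReal.ofReal_mul ENNReal.toReal_nonneg, ENNReal.ofReal_toReal htop]

/-- A probability measure with a continuous density is dominated, up to a factor close to `1`, by
a Boltzmann distribution whose potential is in the dense class. -/
theorem exists_smul_le_boltzmann (hK : IsCompact K) (hvol : 0 < volume K) {𝒱 : Set C(K, ℝ)}
    (h𝒱 : Dense 𝒱) {f : C(K, ℝ)} (hf : ∀ x, 0 ≤ f x)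
    (hprob : IsProbabilityMeasure ((uniform K).withDensity fun x => ENNReal.ofReal (f x)))
    {c : ℝ} (hc0 : 0 < c) (hc1 : c < 1) :
    ∃ V ∈ 𝒱, ENNReal.ofReal c • ((uniform K).withDensity fun x => ENNReal.ofReal (f x)) ≤
      boltzmann K V := by
  have : CompactSpace K := isCompact_iff_compactSpace.1 hK
  have := isProbabilityMeasure_uniform hK hvol
  have hfint : ∫ x, f x ∂(uniform K) = 1 := by
    have h1 := hprob.measure_univ
    rw [withDensity_apply _ MeasurableSet.univ, Measure.restrict_univ,
      ← ofReal_integral_eq_lintegral_ofReal (integrable_of_continuous f.continuous)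
      (Eventually.of_forall hf)] at h1
    exact ENNReal.ofReal_eq_one.1 h1
  -- Three losses of a factor at least `1 - η` occur: mixing with the constant, the sup-norm error
  -- in `exp (-V)`, and the same error in `Z`. Together `(1 - η) ^ 3 ≥ 1 - 3 * η = c`.
  set η : ℝ := (1 - c) / 3 with hη
  have hη0 : 0 < η := by rw [hη]; linarith
  have hη1 : η < 1 / 3 := by rw [hη]; linarith
  set g : C(K, ℝ) := ⟨fun x => (1 - η) * f x + η, by fun_prop⟩ with hg
  have hgpos (x : K) : 0 < g x := by
    have : 0 ≤ (1 - η) * f x := mul_nonneg (by linarith) (hf x)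
    simp only [hg, ContinuousMap.coe_mk]
    linarith
  have hgint : ∫ x, g x ∂(uniform K) = 1 := by
    simp only [hg, ContinuousMap.coe_mk]
    rw [integral_add (integrable_of_continuous (by fun_prop)) (integrable_const _),
      integral_const_mul, hfint]
    simp
  set V₀ : C(K, ℝ) := ⟨fun x => -Real.log (g x),
    (g.continuous.log fun x => (hgpos x).ne').neg⟩ with hV₀
  obtain ⟨V, hV, hVdist⟩ := Metric.dense_iff.1 h𝒱 V₀ η hη0
  have hclose (x : K) : |V x - V₀ x| ≤ η := by
    rw [← Real.dist_eq]
    exact (ContinuousMap.dist_apply_le_dist x).trans (Metric.mem_ball.1 hV).le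
  have hexp (x : K) : Real.exp (-V₀ x) = g x := by
    simp only [hV₀, ContinuousMap.coe_mk, neg_neg]
    exact Real.exp_log (hgpos x)
  have hlow (x : K) : Real.exp (-η) * g x ≤ Real.exp (-V x) := by
    rw [← hexp, ← Real.exp_add]
    exact Real.exp_le_exp.2 (by linarith [(abs_le.1 (hclose x)).2])
  have hupp (x : K) : Real.exp (-V x) ≤ Real.exp η * g x := by
    rw [← hexp, ← Real.exp_add]
    exact Real.exp_le_exp.2 (by linarith [(abs_le.1 (hclose x)).1])
  have hVint : Integrable (fun x => Real.exp (-V x)) (uniform K) :=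
    integrable_of_continuous (by fun_prop)
  have hZ : ∫ x, Real.exp (-V x) ∂(uniform K) ≤ Real.exp η := by
    refine (integral_mono hVint (integrable_of_continuous (by fun_prop)) hupp).trans_eq ?_
    rw [integral_const_mul, hgint, mul_one]
  have hZ0 : 0 < ∫ x, Real.exp (-V x) ∂(uniform K) := integral_exp_pos hVint
  have hcη : c ≤ Real.exp (-η) * (Real.exp (-η) * (1 - η)) := by
    have h1 : 1 - η ≤ Real.exp (-η) := Real.one_sub_le_exp_neg η
    have h2 : 0 < 1 - η := by linarith
    calc c = 1 - 3 * η := by rw [hη]; ring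
      _ ≤ (1 - η) * ((1 - η) * (1 - η)) := by nlinarith [sq_nonneg η]
      _ ≤ Real.exp (-η) * (Real.exp (-η) * (1 - η)) := by gcongr
  refine ⟨V, hVdist, ?_⟩
  rw [boltzmann, ← withDensity_smul' _ _ ENNReal.ofReal_ne_top]
  refine withDensity_mono (Eventually.of_forall fun x => ?_)
  rw [Pi.smul_apply, smul_eq_mul, ← ENNReal.ofReal_mul hc0.le]
  refine ENNReal.ofReal_le_ofReal ?_
  calc c * f x ≤ Real.exp (-η) * (Real.exp (-η) * (1 - η)) * f x :=
        mul_le_mul_of_nonneg_right hcη (hf x)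
    _ = Real.exp (-η) * (Real.exp (-η) * ((1 - η) * f x)) := by ring
    _ ≤ Real.exp (-η) * (Real.exp (-η) * g x) := by
        gcongr
        simp only [hg, ContinuousMap.coe_mk]
        linarith
    _ ≤ (∫ y, Real.exp (-V y) ∂(uniform K))⁻¹ * Real.exp (-V x) := by
        rw [Real.exp_neg η]
        refine mul_le_mul (inv_anti₀ hZ0 hZ) ?_ (by have := hgpos x; positivity) (by positivity)
        rw [← Real.exp_neg]
        exact hlow x

/-! ### Density of the Boltzmann distributions -/

theorem exists_klDiv_boltzmann_lt (hK : IsCompact K) (hvol : 0 < volume K) {𝒱 : Set C(K, ℝ)}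
    (h𝒱 : Dense 𝒱) {Q : Measure K} [IsProbabilityMeasure Q] (hQ : HasContinuousDensity Q)
    {ε : ℝ≥0∞} (hε : 0 < ε) : ∃ V ∈ 𝒱, InformationTheory.klDiv Q (boltzmann K V) < ε := by
  obtain ⟨f, hf, rfl⟩ := hQ.exists_uniform_withDensity hK hvol
  obtain ⟨δ, hδ, hδε⟩ := ENNReal.lt_iff_exists_real_btwn.1 hε
  have hδ0 : 0 < δ := by simpa using hδε.1
  obtain ⟨V, hV, hle⟩ := exists_smul_le_boltzmann hK hvol h𝒱 hf ‹_› (Real.exp_pos (-δ))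
    (Real.exp_lt_one_iff.2 (by linarith))
  have := isProbabilityMeasure_boltzmann hK hvol V
  refine ⟨V, hV, lt_of_le_of_lt (klDiv_le_of_le_smul (Real.exp_pos δ) ?_)
    (by rw [Real.log_exp]; exact hδε.2)⟩
  have h1 : ENNReal.ofReal (Real.exp δ) * ENNReal.ofReal (Real.exp (-δ)) = 1 := by
    rw [← ENNReal.ofReal_mul (Real.exp_pos _).le, ← Real.exp_add]
    simp
  intro s
  have h2 := hle s
  rw [Measure.smul_apply, smul_eq_mul] at h2 ⊢
  rw [← one_mul (((uniform K).withDensity fun x => ENNReal.ofReal (f x)) s), ← h1, mul_assoc]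
  gcongr

theorem exists_tvDist_boltzmann_lt (hK : IsCompact K) (hvol : 0 < volume K) {𝒱 : Set C(K, ℝ)}
    (h𝒱 : Dense 𝒱) {Q : Measure K} [IsProbabilityMeasure Q] (hQ : Q ≪ lebesgue K)
    {ε : ℝ≥0∞} (hε : 0 < ε) : ∃ V ∈ 𝒱, tvDist Q (boltzmann K V) < ε := by
  have : CompactSpace K := isCompact_iff_compactSpace.1 hK
  have := isProbabilityMeasure_uniform hK hvol
  have hQP : Q ≪ uniform K :=
    (lebesgue_eq_smul_uniform hK hvol ▸ hQ).trans Measure.smul_absolutelyContinuous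
  obtain ⟨δ, hδ, hδε⟩ := ENNReal.lt_iff_exists_real_btwn.1 hε
  have hδ0 : 0 < δ := by simpa using hδε.1
  -- On each set there are three errors of size `η` (`L¹` approximation, renormalization, Boltzmann
  -- approximation), and `tvDist_le` doubles their sum. The bound `1 / 2` keeps the mass `m`
  -- positive.
  set η : ℝ := min (δ / 6) (1 / 2) with hη
  have hη0 : 0 < η := by positivity
  have hη1 : η ≤ 1 / 2 := min_le_right _ _
  have hηδ : η ≤ δ / 6 := min_le_left _ _
  set g : K → ℝ := fun x => (Q.rnDeriv (uniform K) x).toReal with hg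
  have hgint : Integrable g (uniform K) := Measure.integrable_toReal_rnDeriv
  have hg0 (x : K) : 0 ≤ g x := ENNReal.toReal_nonneg
  obtain ⟨f₀, hf₀, -⟩ := hgint.exists_boundedContinuous_integral_sub_le hη0
  set f₁ : C(K, ℝ) := ⟨fun x => max (f₀ x) 0, by fun_prop⟩ with hf₁
  have hf₁int : Integrable f₁ (uniform K) := integrable_of_continuous f₁.continuous
  have hf₀int : Integrable f₀ (uniform K) := integrable_of_continuous f₀.continuous
  have hset (s : Set K) (hs : MeasurableSet s) :
      |Q.real s - ∫ x in s, f₁ x ∂(uniform K)| ≤ η := by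
    rw [← Measure.setIntegral_toReal_rnDeriv hQP s, ← integral_sub hgint.integrableOn
      hf₁int.integrableOn]
    calc |∫ x in s, (g x - f₁ x) ∂(uniform K)| ≤ ∫ x in s, |g x - f₁ x| ∂(uniform K) :=
          abs_integral_le_integral_abs
      _ ≤ ∫ x, |g x - f₁ x| ∂(uniform K) :=
          setIntegral_le_integral (hgint.sub hf₁int).abs (Eventually.of_forall fun x => abs_nonneg _)
      _ ≤ ∫ x, ‖g x - f₀ x‖ ∂(uniform K) := by
          refine integral_mono (hgint.sub hf₁int).abs (hgint.sub hf₀int).norm fun x => ?_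
          -- Taking the positive part of `f₀` does not increase its distance to `g`, as `g ≥ 0`.
          have h1 := abs_max_sub_max_le_abs (g x) (f₀ x) 0
          rwa [max_eq_left (hg0 x)] at h1
      _ ≤ η := hf₀
  set m : ℝ := ∫ x, f₁ x ∂(uniform K) with hm
  have hm1 : |1 - m| ≤ η := by simpa using hset Set.univ MeasurableSet.univ
  have hm0 : 0 < m := by linarith [(abs_le.1 hm1).2]
  set f : C(K, ℝ) := m⁻¹ • f₁ with hf
  have hf0 (x : K) : 0 ≤ f x := mul_nonneg (inv_nonneg.2 hm0.le) (le_max_right _ _)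
  set Q' : Measure K := (uniform K).withDensity fun x => ENNReal.ofReal (f x) with hQ'
  have hreal (s : Set K) (hs : MeasurableSet s) :
      Q'.real s = m⁻¹ * ∫ x in s, f₁ x ∂(uniform K) := by
    rw [measureReal_def, hQ', withDensity_apply _ hs, ← ofReal_integral_eq_lintegral_ofReal
      (integrable_of_continuous f.continuous) (Eventually.of_forall hf0),
      ENNReal.toReal_ofReal (integral_nonneg hf0), ← integral_const_mul]
    rfl
  have hprob : IsProbabilityMeasure Q' := by
    constructor
    have h1 := hreal Set.univ MeasurableSet.univ
    rw [Measure.restrict_univ, inv_mul_cancel₀ hm0.ne', measureReal_def] at h1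
    rw [← ENNReal.toReal_eq_one_iff]
    exact h1
  obtain ⟨V, hV, hle⟩ := exists_smul_le_boltzmann hK hvol h𝒱 hf0 hprob (c := 1 - η) (by linarith)
    (by linarith)
  have := isProbabilityMeasure_boltzmann hK hvol V
  refine ⟨V, hV, lt_of_le_of_lt (tvDist_le (η := δ / 2) fun s hs => ?_)
    (by convert hδε.2 using 2; ring)⟩
  have h1 := abs_real_sub_real_le_of_smul_le (by linarith) (by linarith) hle hs
  have h2 := hset s hs
  have h3 : |(∫ x in s, f₁ x ∂(uniform K)) - Q'.real s| ≤ η := by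
    have h4 : (∫ x in s, f₁ x ∂(uniform K)) = m * Q'.real s := by
      rw [hreal s hs, mul_inv_cancel_left₀ hm0.ne']
    rw [h4, ← sub_one_mul, abs_mul, abs_sub_comm, abs_of_nonneg measureReal_nonneg]
    exact (mul_le_of_le_one_right (abs_nonneg _) measureReal_le_one).trans hm1
  rw [abs_le] at *
  constructor <;> linarith

theorem exists_wasserstein_boltzmann_lt (hK : IsCompact K) (hvol : 0 < volume K)
    {𝒱 : Set C(K, ℝ)} (h𝒱 : Dense 𝒱) {Q : Measure K} [IsProbabilityMeasure Q]
    (hQ : Q.support ⊆ (uniform K).support) {p : ℝ} (hp : 0 < p) {ε : ℝ≥0∞} (hε : 0 < ε) :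
    ∃ V ∈ 𝒱, wasserstein p Q (boltzmann K V) < ε := by
  have : CompactSpace K := isCompact_iff_compactSpace.1 hK
  have := isProbabilityMeasure_uniform hK hvol
  obtain ⟨e, he, heε⟩ := ENNReal.lt_iff_exists_real_btwn.1 hε
  have he0 : 0 < e := by simpa using heε.1
  obtain ⟨f, π, hf, hprob, hπ, hcost⟩ :=
    exists_coupling_continuous_density hQ (half_pos he0) hp
  set D : ℝ := Metric.diam (Set.univ : Set K) with hD
  have hD0 : 0 ≤ D := Metric.diam_nonneg
  have hDdist (x y : K) : edist x y ^ p ≤ ENNReal.ofReal (D ^ p) := by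
    rw [← ENNReal.ofReal_rpow_of_nonneg hD0 hp.le, edist_dist]
    gcongr
    exact Metric.dist_le_diam_of_mem isCompact_univ.isBounded trivial trivial
  have hlt : (e / 2) ^ p < e ^ p := Real.rpow_lt_rpow (by positivity) (by linarith) hp
  -- Smoothing at scale `e / 2` leaves room below `e ^ p`: as `c → 1` the cost of the leftover mass,
  -- at most `D ^ p * (1 - c)`, disappears.
  have htend : Tendsto (fun c : ℝ => c * (e / 2) ^ p + D ^ p * (1 - c)) (𝓝[<] 1)
      (𝓝 ((e / 2) ^ p)) := by
    have h1 : Continuous fun c : ℝ => c * (e / 2) ^ p + D ^ p * (1 - c) := by fun_prop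
    have h2 := (h1.tendsto 1).mono_left (nhdsWithin_le_nhds (s := Set.Iio 1))
    simpa using h2
  obtain ⟨c, hc, hc0, hc1⟩ := ((htend.eventually_lt_const hlt).and
    (Ioo_mem_nhdsLT (zero_lt_one (α := ℝ)))).exists
  obtain ⟨V, hV, hle⟩ := exists_smul_le_boltzmann hK hvol h𝒱 hf hprob hc0 hc1
  have := isProbabilityMeasure_boltzmann hK hvol V
  refine ⟨V, hV, lt_trans ?_ heε.2⟩
  rw [← ENNReal.rpow_lt_rpow_iff hp]
  refine (wasserstein_rpow_le_of_smul_le hp hπ hcost hDdist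
    (ENNReal.ofReal_le_one.2 hc1.le) hle).trans_lt ?_
  rw [ENNReal.ofReal_rpow_of_nonneg (by positivity) hp.le,
    ENNReal.ofReal_rpow_of_nonneg he0.le hp.le, ← ENNReal.ofReal_one,
    ← ENNReal.ofReal_sub _ hc0.le, ← ENNReal.ofReal_mul hc0.le,
    ← ENNReal.ofReal_mul (by positivity), ← ENNReal.ofReal_add (by positivity)
    (mul_nonneg (by positivity) (by linarith))]
  exact (ENNReal.ofReal_lt_ofReal_iff (by positivity)).2 hc

theorem universalApproximation_of_dense (hK : IsCompact K) (hvol : 0 < volume K)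
    {𝒱 : Set C(K, ℝ)} (h𝒱 : Dense 𝒱) : UniversalApproximation K 𝒱 :=
  ⟨fun V _ => ⟨isProbabilityMeasure_boltzmann hK hvol V, hasContinuousDensity_boltzmann hK hvol V⟩,
    fun _ hp _ _ hQ _ hε =>
      exists_wasserstein_boltzmann_lt hK hvol h𝒱 hQ (zero_lt_one.trans_le hp) hε,
    fun _ _ hQ _ hε => exists_tvDist_boltzmann_lt hK hvol h𝒱 hQ hε,
    fun _ _ hQ _ hε => exists_klDiv_boltzmann_lt hK hvol h𝒱 hQ hε⟩

end BiasPotential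

end

theorem mainTheorem7 (d : ℕ) (K : Set (BiasPotential.Space d)) (hK : IsCompact K)
    (hvol : 0 < volume K) :
    (∀ 𝒱 : Set C(K, ℝ), Dense 𝒱 → BiasPotential.UniversalApproximation K 𝒱) ∧
    (∀ σ : ℝ → ℝ, Continuous σ → BiasPotential.NonPolynomial σ →
      Dense (BiasPotential.barronSpace σ K) ∧
      BiasPotential.UniversalApproximation K (BiasPotential.barronSpace σ K)) ∧
    (∀ (σ : ℝ → ℝ) (ρ₀ : Measure (BiasPotential.Space d × ℝ)), IsProbabilityMeasure ρ₀ →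
      BiasPotential.RandomFeatureAssumption σ ρ₀ →
      Dense (BiasPotential.rkhsSpace σ ρ₀ K) ∧
      BiasPotential.UniversalApproximation K (BiasPotential.rkhsSpace σ ρ₀ K)) := by
  refine ⟨fun 𝒱 h => BiasPotential.universalApproximation_of_dense hK hvol h,
    fun σ hσ hp => ?_, fun σ ρ₀ _ h => ?_⟩
  · have h := BiasPotential.dense_barronSpace hK hσ hp
    exact ⟨h, BiasPotential.universalApproximation_of_dense hK hvol h⟩
  · have h := BiasPotential.dense_rkhsSpace hK h
    exact ⟨h, BiasPotential.universalApproximation_of_dense hK hvol h⟩
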